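/- **Theorem 3.2.** Let $V$ be a real vector space, of finite or infinite dimension, with $\dim V\ge 3$. Let $C\subseteq V$ be a cone, i.e. $C$ is convex, $\lambda C\subseteq C$ for all $\lambda\ge 0$ and $C\cap(-C)=\{0\}$, and write $x\le_C y$ if $y-x\in C$. Suppose that $C$ is Archimedean (if $x\in V$, $y\in C$ and $nx\le_C y$ for all $n=1,2,\dots$, then $x\le_C 0$) and that $u\in C$ is an order unit (for each $x\in V$ there is $\lambda\ge 0$ with $x\le_C\lambda u$), so that $(V,C,u)$ is an order unit space. Let $C^\circ$ and $\partial C$ be the interior and the boundary of $C$ with respect to the order unit norm $\|x\|_u=\inf\{\lambda>0:-\lambda u\le_C x\le_C\lambda u\}$; completeness of this norm is not assumed. Suppose that $C$ is strictly convex: for all linearly independent $x,y\in\partial C$ the segment $\{(1-\lambda)x+\lambda y:0<\lambda<1\}$ is contained in $C^\circ$. If there is a bijection $g\colon C^\circ\to C^\circ$ which is antihomogeneous ($g(\lambda x)=\lambda^{-1}g(x)$ for all $\lambda>0$ and $x\in C^\circ$) and an order-antimorphism ($x\le_C y$ if and only if $g(y)\le_C g(x)$, for all $x,y\in C^\circ$),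 then $C$ is smooth: for each $\eta\in\partial C$ with $\eta\ne 0$ there is exactly one state $\phi$ with $\phi(\eta)=0$, where a state is a linear functional $\phi\colon V\to\mathbb{R}$ with $\phi(C)\subseteq[0,\infty)$ and $\phi(u)=1$. -/

import Mathlib

namespace OrderUnit

section

variable {V : Type*} [AddCommGroup V] [Module ℝ V]

/-- The relation `x ≤_C y` induced by a cone `C`, meaning `y - x ∈ C`. -/
def ConeLE (C : PointedCone ℝ V) (x y : V) : Prop := y - x ∈ C

/-- `(V, C, u)` is an order unit space: `C` is a cone (a convex set, closed under multiplication by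
nonnegative scalars, with `C ∩ -C = {0}`), `C` is Archimedean, and `u ∈ C` is an order unit. -/
structure IsOrderUnitSpace (C : PointedCone ℝ V) (u : V) : Prop where
  salient : ∀ x : V, x ∈ C → -x ∈ C → x = 0
  archimedean : ∀ x y : V, y ∈ C → (∀ n : ℕ, 1 ≤ n → ConeLE C ((n : ℝ) • x) y) → ConeLE C x 0
  unit_mem : u ∈ C
  order_unit : ∀ x : V, ∃ r : ℝ, 0 ≤ r ∧ ConeLE C x (r • u)

/-- The order unit norm `‖x‖_u = inf {r > 0 : -r u ≤_C x ≤_C r u}`. -/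
noncomputable def orderUnitNorm (C : PointedCone ℝ V) (u x : V) : ℝ :=
  sInf {r : ℝ | 0 < r ∧ ConeLE C (-(r • u)) x ∧ ConeLE C x (r • u)}

/-- The topology of the order unit norm: a set is open when it contains, around each of its points,
a ball of positive radius for `‖·‖_u`. -/
@[reducible] def orderUnitTopology (C : PointedCone ℝ V) (u : V) : TopologicalSpace V where
  IsOpen U := ∀ x ∈ U, ∃ ε : ℝ, 0 < ε ∧ ∀ y : V, orderUnitNorm C u (y - x) < ε → y ∈ U
  isOpen_univ := fun _ _ => ⟨1, one_pos, fun _ _ => trivial⟩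
  isOpen_inter := by
    intro s t hs ht x hx
    obtain ⟨ε, hε, h⟩ := hs x hx.1
    obtain ⟨δ, hδ, k⟩ := ht x hx.2
    exact ⟨min ε δ, lt_min hε hδ, fun y hy =>
      ⟨h y (hy.trans_le (min_le_left _ _)), k y (hy.trans_le (min_le_right _ _))⟩⟩
  isOpen_sUnion := by
    intro s hs x hx
    obtain ⟨t, hts, hxt⟩ := hx
    obtain ⟨ε, hε, h⟩ := hs t hts x hxt
    exact ⟨ε, hε, fun y hy => ⟨t, hts, h y hy⟩⟩

/-- The interior `C°` of the cone in the order unit norm topology. -/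
def coneInterior (C : PointedCone ℝ V) (u : V) : Set V :=
  @interior V (orderUnitTopology C u) (C : Set V)

/-- The boundary `∂C` of the cone in the order unit norm topology. -/
def coneBoundary (C : PointedCone ℝ V) (u : V) : Set V :=
  @frontier V (orderUnitTopology C u) (C : Set V)

/-- `C` is strictly convex: for linearly independent `x, y ∈ ∂C` the segment
`{(1 - t) x + t y : 0 < t < 1}` is contained in `C°`. -/
def IsStrictlyConvexCone (C : PointedCone ℝ V) (u : V) : Prop :=
  ∀ x ∈ coneBoundary C u, ∀ y ∈ coneBoundary C u, LinearIndependent ℝ ![x, y] →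
    ∀ t : ℝ, 0 < t → t < 1 → (1 - t) • x + t • y ∈ coneInterior C u

/-- `φ` is a state of `(V, C, u)`: a positive linear functional with `φ u = 1`. Positivity makes
such a functional continuous for the order unit norm. -/
def IsState (C : PointedCone ℝ V) (u : V) (φ : V →ₗ[ℝ] ℝ) : Prop :=
  (∀ x ∈ C, 0 ≤ φ x) ∧ φ u = 1

/-- `C` is smooth: every nonzero `η ∈ ∂C` is annihilated by exactly one state. -/
def IsSmoothCone (C : PointedCone ℝ V) (u : V) : Prop :=
  ∀ η ∈ coneBoundary C u, η ≠ 0 → ∃! φ : V →ₗ[ℝ] ℝ, IsState C u φ ∧ φ η = 0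

/-- `g` is antihomogeneous on `C°`. Only the values of `g` on `C°` matter. -/
def IsAntihomogeneous (C : PointedCone ℝ V) (u : V) (g : V → V) : Prop :=
  ∀ r : ℝ, 0 < r → ∀ x ∈ coneInterior C u, g (r • x) = (1 / r) • g x

/-- `g` is an order-antimorphism on `C°`. Only the values of `g` on `C°` matter. -/
def IsOrderAntimorphism (C : PointedCone ℝ V) (u : V) (g : V → V) : Prop :=
  ∀ x ∈ coneInterior C u, ∀ y ∈ coneInterior C u, ConeLE C x y ↔ ConeLE C (g y) (g x)

end

end OrderUnit

/-!
The inversion of a spin factor is `z⁻¹ = (tr z • 1 - z) / det z`, where `tr z` and `det z` are the sum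
and the product of the two eigenvalues of `z`. The proof shows that `g` has this shape at every
interior base point `x`, and compares two base points.

For an order unit `x`, let `lo C x v` be the largest `r` with `r • x ≤ v` and `hi C x v` the least `r`
with `v ≤ r • x`. These are the eigenvalues in the model, and `g` inverts them:
`lo (g x) (g z) = (hi x z)⁻¹` and `hi (g x) (g z) = (lo x z)⁻¹`. Put
`T z = (hi x z + lo x z) • g x - (hi x z * lo x z) • g z` (`spectralMap`).

* By strict convexity the nonzero boundary elements of the cone are extreme. Hence `g` preserves
  projective segments, and `T (z + r • x) = T z + r • g x` (`spectralMap_add_smul`). So `T` extends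
  to a map `V → V` (`spectralExt`) compatible with adding multiples of `x` and `g x`.
* `T` is minus the directional derivative of `g` at `x`, so it is monotone, and applying the same to
  `g⁻¹` at `g x` makes it an order isomorphism (`spectralExt_le_iff`, `spectralExt_surjective`).
  Being compatible with adding multiples of the order units, it is an isometry between the
  norms of `x` and of `g x`, hence linear by the Mazur–Ulam theorem (`isLinearMap_spectralExt`).
* Near an interior point `y` not proportional to `x`, the base points `x` and `y` give two formulas
  for `g (y + t • v)`. Along the ray from `y` the bounds relative to `y` are affine, so the second
  formula has a derivative at `t = 0` that is linear in `v`. In the first one the coefficients of the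
  independent vectors `g x` and `g y` recover the one-sided derivatives of `hi C x` and `lo C x`,
  which are therefore linear in `v` (`hiDeriv_loDeriv_identity`, `isLinearMap_loDeriv`).
* For a boundary element `η ≠ 0` take `x = u` and `y = u + η`. The function `lo C u` is the infimum of
  all states, and the states vanishing at `η` are those that attain it at `y`. The derivative of
  `lo C u` at `y`, being linear, is such a state, and any other one dominates it and so equals it
  (`existsUnique_isState`).
-/

namespace OrderUnit

/-! ### Lower and upper bounds relative to an order unit -/

section Bounds

variable {V : Type*} [AddCommGroup V] [Module ℝ V] {C : PointedCone ℝ V} {u x z : V}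

/-- The largest `r` with `r • x ≤_C v`, for an order unit `x`. -/
noncomputable def lo (C : PointedCone ℝ V) (x v : V) : ℝ := sSup {r : ℝ | v - r • x ∈ C}

/-- The least `r` with `v ≤_C r • x`, for an order unit `x`. -/
noncomputable def hi (C : PointedCone ℝ V) (x v : V) : ℝ := -lo C x (-v)

theorem mem_cone_of_eq {a b : V} (e : a = b) (h : b ∈ C) : a ∈ C := e ▸ h

namespace IsOrderUnitSpace

/-- Archimedean cones are closed in the direction of an order unit. -/
theorem mem_of_forall_add_smul_mem (hx : IsOrderUnitSpace C x)
    (h : ∀ ε : ℝ, 0 < ε → z + ε • x ∈ C) : z ∈ C := by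
  have key : ConeLE C (-z) 0 := by
    refine hx.archimedean (-z) x hx.unit_mem fun n hn => ?_
    have hn' : (0 : ℝ) < n := by exact_mod_cast hn
    refine mem_cone_of_eq ?_ (C.smul_mem hn'.le (h (n : ℝ)⁻¹ (inv_pos.2 hn')))
    rw [smul_add, smul_smul, mul_inv_cancel₀ hn'.ne']
    module
  simpa [ConeLE] using key

theorem exists_pos_smul_sub_mem (hx : IsOrderUnitSpace C x) (v : V) :
    ∃ r : ℝ, 0 < r ∧ r • x - v ∈ C := by
  obtain ⟨r, hr, h⟩ := hx.order_unit v
  exact ⟨r + 1, by linarith, mem_cone_of_eq (by module) (C.add_mem h hx.unit_mem)⟩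

theorem eq_of_sub_mem (hx : IsOrderUnitSpace C x) {v w : V} (h : v - w ∈ C) (h' : w - v ∈ C) :
    v = w :=
  sub_eq_zero.1 (hx.salient _ h (mem_cone_of_eq (by module) h'))

/-- A version of closedness of `C`: the constant term of a quadratic polynomial with vector
coefficients lies in `C` if all its values at positive reals do. -/
theorem mem_of_forall_quadratic_mem (hx : IsOrderUnitSpace C x) {a b d : V}
    (h : ∀ ε : ℝ, 0 < ε → a + ε • b + ε ^ 2 • d ∈ C) : a ∈ C := by
  obtain ⟨r, hr, hb⟩ := hx.exists_pos_smul_sub_mem b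
  obtain ⟨s, hs, hd⟩ := hx.exists_pos_smul_sub_mem d
  refine hx.mem_of_forall_add_smul_mem fun ε hε => ?_
  have hrs : 0 < r + s := by positivity
  -- With `δ ≤ 1` the two error terms are together at most `δ * (r + s) • x ≤_C ε • x`.
  set δ := min 1 (ε / (r + s)) with hδ
  have hδ0 : 0 < δ := lt_min one_pos (by positivity)
  have hδ1 : δ ≤ 1 := min_le_left _ _
  have hδ2 : δ * (r + s) ≤ ε := by
    rw [← le_div_iff₀ hrs]; exact min_le_right _ _
  have hδ3 : δ ^ 2 * s ≤ δ * s :=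
    mul_le_mul_of_nonneg_right (pow_le_of_le_one hδ0.le hδ1 two_ne_zero) hs.le
  have hc : 0 ≤ ε - δ * r - δ ^ 2 * s := by linarith
  have := C.add_mem (C.add_mem (C.add_mem (h δ hδ0) (C.smul_mem hδ0.le hb))
    (C.smul_mem (sq_nonneg δ) hd)) (C.smul_mem hc hx.unit_mem)
  exact mem_cone_of_eq (by module) this

theorem le_of_sub_smul_mem (hx : IsOrderUnitSpace C x) (hx0 : x ≠ 0) {v : V} {r s : ℝ}
    (hr : v - r • x ∈ C) (hs : s • x - v ∈ C) : r ≤ s := by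
  by_contra! hlt
  have h1 : (s - r) • x ∈ C := mem_cone_of_eq (by module) (C.add_mem hr hs)
  have h2 : -x ∈ C := (C.smul_mem_iff (sub_pos.2 hlt)).1 (mem_cone_of_eq (by module) h1)
  exact hx0 (hx.salient x hx.unit_mem h2)

theorem le_lo_iff (hx : IsOrderUnitSpace C x) (hx0 : x ≠ 0) {v : V} {r : ℝ} :
    r ≤ lo C x v ↔ v - r • x ∈ C := by
  obtain ⟨R, -, hR⟩ := hx.exists_pos_smul_sub_mem v
  obtain ⟨S, -, hS⟩ := hx.exists_pos_smul_sub_mem (-v)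
  have hbdd : BddAbove {r : ℝ | v - r • x ∈ C} := ⟨R, fun r hr => hx.le_of_sub_smul_mem hx0 hr hR⟩
  have hne : {r : ℝ | v - r • x ∈ C}.Nonempty := ⟨-S, mem_cone_of_eq (by module) hS⟩
  refine ⟨fun h => ?_, fun h => le_csSup hbdd h⟩
  refine hx.mem_of_forall_add_smul_mem fun ε hε => ?_
  obtain ⟨s, hs, hlt⟩ := exists_lt_of_lt_csSup hne (show r - ε < lo C x v by linarith)
  exact mem_cone_of_eq (by module)
    (C.add_mem hs (C.smul_mem (show 0 ≤ s - (r - ε) by linarith) hx.unit_mem))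

theorem hi_le_iff (hx : IsOrderUnitSpace C x) (hx0 : x ≠ 0) {v : V} {r : ℝ} :
    hi C x v ≤ r ↔ r • x - v ∈ C := by
  rw [hi, neg_le, hx.le_lo_iff hx0, show -v - -r • x = r • x - v by module]

theorem sub_lo_smul_mem (hx : IsOrderUnitSpace C x) (hx0 : x ≠ 0) (v : V) :
    v - lo C x v • x ∈ C := (hx.le_lo_iff hx0).1 le_rfl

theorem hi_smul_sub_mem (hx : IsOrderUnitSpace C x) (hx0 : x ≠ 0) (v : V) :
    hi C x v • x - v ∈ C := (hx.hi_le_iff hx0).1 le_rfl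

theorem lo_le_hi (hx : IsOrderUnitSpace C x) (hx0 : x ≠ 0) (v : V) : lo C x v ≤ hi C x v :=
  hx.le_of_sub_smul_mem hx0 (hx.sub_lo_smul_mem hx0 v) (hx.hi_smul_sub_mem hx0 v)

theorem eq_smul_of_lo_eq_hi (hx : IsOrderUnitSpace C x) (hx0 : x ≠ 0) {v : V}
    (h : lo C x v = hi C x v) : v = hi C x v • x :=
  hx.eq_of_sub_mem (h ▸ hx.sub_lo_smul_mem hx0 v) (hx.hi_smul_sub_mem hx0 v)

theorem lo_add_smul (hx : IsOrderUnitSpace C x) (hx0 : x ≠ 0) (v : V) (r : ℝ) :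
    lo C x (v + r • x) = lo C x v + r := by
  refine eq_of_forall_le_iff fun c => ?_
  rw [hx.le_lo_iff hx0, ← sub_le_iff_le_add, hx.le_lo_iff hx0,
    show v + r • x - c • x = v - (c - r) • x by module]

theorem hi_add_smul (hx : IsOrderUnitSpace C x) (hx0 : x ≠ 0) (v : V) (r : ℝ) :
    hi C x (v + r • x) = hi C x v + r := by
  rw [hi, hi, show -(v + r • x) = -v + (-r) • x by module, hx.lo_add_smul hx0]
  ring

theorem lo_smul (hx : IsOrderUnitSpace C x) (hx0 : x ≠ 0) (v : V) {r : ℝ} (hr : 0 < r) :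
    lo C x (r • v) = r * lo C x v := by
  refine eq_of_forall_le_iff fun c => ?_
  have e : r • v - c • x = r • (v - (c / r) • x) := by
    rw [smul_sub, smul_smul, mul_div_cancel₀ c hr.ne']
  rw [hx.le_lo_iff hx0, ← div_le_iff₀' hr, hx.le_lo_iff hx0, e, C.smul_mem_iff hr]

theorem hi_smul (hx : IsOrderUnitSpace C x) (hx0 : x ≠ 0) (v : V) {r : ℝ} (hr : 0 < r) :
    hi C x (r • v) = r * hi C x v := by
  rw [hi, hi, ← smul_neg, hx.lo_smul hx0 _ hr, mul_neg]

theorem lo_self (hx : IsOrderUnitSpace C x) (hx0 : x ≠ 0) : lo C x x = 1 := by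
  refine le_antisymm ?_ ((hx.le_lo_iff hx0).2 (mem_cone_of_eq (by module) C.zero_mem))
  exact hx.le_of_sub_smul_mem hx0 (hx.sub_lo_smul_mem hx0 x)
    (mem_cone_of_eq (show _ = (0 : V) by module) C.zero_mem)

theorem hi_self (hx : IsOrderUnitSpace C x) (hx0 : x ≠ 0) : hi C x x = 1 := by
  refine le_antisymm ((hx.hi_le_iff hx0).2 (mem_cone_of_eq (by module) C.zero_mem)) ?_
  rw [← hx.lo_self hx0]
  exact hx.lo_le_hi hx0 x

theorem lo_zero (hx : IsOrderUnitSpace C x) (hx0 : x ≠ 0) : lo C x (0 : V) = 0 := by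
  have := hx.lo_add_smul hx0 0 1
  rw [zero_add, one_smul, hx.lo_self hx0] at this
  linarith

theorem hi_zero (hx : IsOrderUnitSpace C x) (hx0 : x ≠ 0) : hi C x (0 : V) = 0 := by
  rw [hi, neg_zero, hx.lo_zero hx0, neg_zero]

/-- An element whose two bounds relative to `x` differ is not proportional to `x`. -/
theorem eq_zero_of_smul_eq_smul (hx : IsOrderUnitSpace C x)
    (hx0 : x ≠ 0) (hne : lo C x z ≠ hi C x z) {r s : ℝ} (hrs : r • x = s • z) :
    r = 0 ∧ s = 0 := by
  have hs : s = 0 := by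
    by_contra hs
    have hz : z = 0 + (r / s) • x := by
      rw [zero_add, div_eq_inv_mul, mul_smul, hrs, smul_smul, inv_mul_cancel₀ hs, one_smul]
    apply hne
    rw [hz, hx.lo_add_smul hx0, hx.hi_add_smul hx0, hx.lo_zero hx0, hx.hi_zero hx0]
  refine ⟨?_, hs⟩
  rw [hs, zero_smul] at hrs
  exact (smul_eq_zero.1 hrs).resolve_right hx0

theorem hi_add_le (hx : IsOrderUnitSpace C x) (hx0 : x ≠ 0) (v w : V) :
    hi C x (v + w) ≤ hi C x v + hi C x w :=
  (hx.hi_le_iff hx0).2 (mem_cone_of_eq (by module)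
    (C.add_mem (hx.hi_smul_sub_mem hx0 v) (hx.hi_smul_sub_mem hx0 w)))

theorem lo_mono (hx : IsOrderUnitSpace C x) (hx0 : x ≠ 0) {v w : V} (h : w - v ∈ C) :
    lo C x v ≤ lo C x w :=
  (hx.le_lo_iff hx0).2 (mem_cone_of_eq (by module) (C.add_mem (hx.sub_lo_smul_mem hx0 v) h))

theorem mem_cone_iff_lo_nonneg (hx : IsOrderUnitSpace C x) (hx0 : x ≠ 0) {v : V} :
    v ∈ C ↔ 0 ≤ lo C x v := by
  rw [hx.le_lo_iff hx0, zero_smul, sub_zero]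

theorem lo_pos_iff (hx : IsOrderUnitSpace C x) (hx0 : x ≠ 0) {v : V} :
    0 < lo C x v ↔ ∃ ε : ℝ, 0 < ε ∧ v - ε • x ∈ C :=
  ⟨fun h => ⟨_, h, hx.sub_lo_smul_mem hx0 v⟩,
    fun ⟨_, hε, h⟩ => hε.trans_le ((hx.le_lo_iff hx0).2 h)⟩

/-- An element which dominates a positive multiple of an order unit is an order unit. -/
theorem of_sub_smul_mem (hx : IsOrderUnitSpace C x) {ε : ℝ} (hε : 0 < ε) (hz : z - ε • x ∈ C) :
    IsOrderUnitSpace C z where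
  salient := hx.salient
  archimedean := hx.archimedean
  unit_mem := mem_cone_of_eq (by module) (C.add_mem hz (C.smul_mem hε.le hx.unit_mem))
  order_unit v := by
    obtain ⟨r, hr, h⟩ := hx.exists_pos_smul_sub_mem v
    refine ⟨r / ε, by positivity, mem_cone_of_eq ?_
      (C.add_mem h (C.smul_mem (show 0 ≤ r / ε by positivity) hz))⟩
    rw [smul_sub, smul_smul, div_mul_cancel₀ r hε.ne']
    module

end IsOrderUnitSpace

end Bounds

/-! ### Interior and boundary of the cone -/

section Topology

variable {V : Type*} [AddCommGroup V] [Module ℝ V] {C : PointedCone ℝ V} {u x z : V}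

namespace IsOrderUnitSpace

theorem orderUnitNorm_le (hu : IsOrderUnitSpace C u) {r : ℝ} (hr : 0 < r) :
    orderUnitNorm C u (-(r • u)) ≤ r :=
  csInf_le ⟨0, fun _ h => h.1.le⟩ ⟨hr, mem_cone_of_eq (sub_self _) C.zero_mem,
    mem_cone_of_eq (show _ = (r + r) • u by module) (C.smul_mem (by positivity) hu.unit_mem)⟩

theorem bounds_of_orderUnitNorm_lt (hu : IsOrderUnitSpace C u) {r : ℝ} {v : V}
    (h : orderUnitNorm C u v < r) : r • u + v ∈ C ∧ r • u - v ∈ C := by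
  obtain ⟨R, hR, hRv⟩ := hu.exists_pos_smul_sub_mem v
  obtain ⟨S, hS, hSv⟩ := hu.exists_pos_smul_sub_mem (-v)
  have hne : {r : ℝ | 0 < r ∧ ConeLE C (-(r • u)) v ∧ ConeLE C v (r • u)}.Nonempty := by
    refine ⟨R + S, by positivity, ?_, ?_⟩
    · exact mem_cone_of_eq (by module) (C.add_mem hSv (C.smul_mem hR.le hu.unit_mem))
    · exact mem_cone_of_eq (by module) (C.add_mem hRv (C.smul_mem hS.le hu.unit_mem))
  obtain ⟨s, ⟨-, h1, h2⟩, hlt⟩ := exists_lt_of_csInf_lt hne h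
  have h3 := C.smul_mem (sub_pos.2 hlt).le hu.unit_mem
  exact ⟨mem_cone_of_eq (by module) (C.add_mem h1 h3),
    mem_cone_of_eq (by module) (C.add_mem h2 h3)⟩

theorem mem_coneInterior_iff (hu : IsOrderUnitSpace C u) :
    z ∈ coneInterior C u ↔ ∃ ε : ℝ, 0 < ε ∧ z - ε • u ∈ C := by
  let := orderUnitTopology C u
  constructor
  · rintro ⟨U, ⟨hU, hUC⟩, hz⟩
    obtain ⟨ε, hε, h⟩ := hU z hz
    refine ⟨ε / 2, by positivity, hUC (h _ ?_)⟩
    rw [show z - (ε / 2) • u - z = -((ε / 2) • u) by module]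
    exact (hu.orderUnitNorm_le (half_pos hε)).trans_lt (half_lt_self hε)
  · intro hz
    refine ⟨{z | ∃ ε : ℝ, 0 < ε ∧ z - ε • u ∈ C}, ⟨?_, ?_⟩, hz⟩
    · rintro w ⟨ε, hε, hw⟩
      refine ⟨ε / 2, half_pos hε, fun y hy => ⟨ε / 2, half_pos hε, ?_⟩⟩
      exact mem_cone_of_eq (by module) (C.add_mem hw (hu.bounds_of_orderUnitNorm_lt hy).1)
    · rintro w ⟨ε, hε, hw⟩
      exact mem_cone_of_eq (by module) (C.add_mem hw (C.smul_mem hε.le hu.unit_mem))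

/-- The cone of an order unit space is closed, so its boundary is the complement of the interior
in `C`. -/
theorem mem_coneBoundary_iff (hu : IsOrderUnitSpace C u) :
    z ∈ coneBoundary C u ↔ z ∈ C ∧ z ∉ coneInterior C u := by
  let := orderUnitTopology C u
  have hcl : IsClosed (C : Set V) := by
    refine ⟨fun w hw => ?_⟩
    have : ∃ ε : ℝ, 0 < ε ∧ w + ε • u ∉ C := by
      by_contra! h
      exact hw (hu.mem_of_forall_add_smul_mem h)
    obtain ⟨ε, hε, hn⟩ := this
    refine ⟨ε, hε, fun y hy hyC => hn ?_⟩
    exact mem_cone_of_eq (by module) (C.add_mem hyC (hu.bounds_of_orderUnitNorm_lt hy).2)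
  change z ∈ frontier (C : Set V) ↔ _
  rw [hcl.frontier_eq]
  rfl

theorem of_mem_coneInterior (hu : IsOrderUnitSpace C u) (hx : x ∈ coneInterior C u) :
    IsOrderUnitSpace C x := by
  obtain ⟨ε, hε, h⟩ := hu.mem_coneInterior_iff.1 hx
  exact hu.of_sub_smul_mem hε h

theorem unit_mem_coneInterior (hu : IsOrderUnitSpace C u) : u ∈ coneInterior C u :=
  hu.mem_coneInterior_iff.2 ⟨1, one_pos, mem_cone_of_eq (by module) C.zero_mem⟩

theorem ne_zero_of_mem_coneInterior (hu : IsOrderUnitSpace C u) (hu0 : u ≠ 0)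
    (hx : x ∈ coneInterior C u) : x ≠ 0 := by
  rintro rfl
  obtain ⟨ε, hε, h⟩ := hu.mem_coneInterior_iff.1 hx
  exact hu0 (hu.salient u hu.unit_mem ((C.smul_mem_iff hε).1 (mem_cone_of_eq (by module) h)))

/-- The interior does not depend on the interior point chosen as order unit. -/
theorem mem_coneInterior_iff_lo_pos (hu : IsOrderUnitSpace C u) (hu0 : u ≠ 0)
    (hx : x ∈ coneInterior C u) : z ∈ coneInterior C u ↔ 0 < lo C x z := by
  have hx' := hu.of_mem_coneInterior hx
  rw [hx'.lo_pos_iff (hu.ne_zero_of_mem_coneInterior hu0 hx), hu.mem_coneInterior_iff]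
  constructor
  · rintro ⟨ε, hε, h⟩
    obtain ⟨r, hr, h'⟩ := hu.exists_pos_smul_sub_mem x
    refine ⟨ε / r, by positivity, mem_cone_of_eq ?_
      (C.add_mem h (C.smul_mem (show 0 ≤ ε / r by positivity) h'))⟩
    rw [smul_sub, smul_smul, div_mul_cancel₀ _ hr.ne']
    module
  · rintro ⟨ε, hε, h⟩
    obtain ⟨δ, hδ, h'⟩ := hu.mem_coneInterior_iff.1 hx
    exact ⟨ε * δ, by positivity,
      mem_cone_of_eq (by module) (C.add_mem h (C.smul_mem hε.le h'))⟩

theorem mem_of_mem_coneInterior (hu : IsOrderUnitSpace C u) (hx : x ∈ coneInterior C u) : x ∈ C :=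
  (hu.of_mem_coneInterior hx).unit_mem

theorem add_mem_coneInterior (hu : IsOrderUnitSpace C u) (hx : x ∈ coneInterior C u) (hz : z ∈ C) :
    x + z ∈ coneInterior C u := by
  obtain ⟨ε, hε, h⟩ := hu.mem_coneInterior_iff.1 hx
  exact hu.mem_coneInterior_iff.2 ⟨ε, hε, mem_cone_of_eq (by module) (C.add_mem h hz)⟩

theorem smul_mem_coneInterior (hu : IsOrderUnitSpace C u) (hx : x ∈ coneInterior C u) {r : ℝ}
    (hr : 0 < r) : r • x ∈ coneInterior C u := by
  obtain ⟨ε, hε, h⟩ := hu.mem_coneInterior_iff.1 hx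
  exact hu.mem_coneInterior_iff.2 ⟨r * ε, by positivity,
    mem_cone_of_eq (by module) (C.smul_mem hr.le h)⟩

/-- In a strictly convex cone, nonzero boundary elements are extreme: a decomposition of one into a
sum within the cone is proportional. -/
theorem exists_eq_smul_add (hu : IsOrderUnitSpace C u) (hC : IsStrictlyConvexCone C u) {s t : V}
    (hs : s ∈ C) (ht : t ∈ C) (hst : s + t ∉ coneInterior C u) (h0 : s + t ≠ 0) :
    ∃ κ : ℝ, s = κ • (s + t) := by
  have hs' : s ∈ coneBoundary C u :=
    hu.mem_coneBoundary_iff.2 ⟨hs, fun h => hst (hu.add_mem_coneInterior h ht)⟩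
  have ht' : t ∈ coneBoundary C u :=
    hu.mem_coneBoundary_iff.2 ⟨ht, fun h => hst (add_comm t s ▸ hu.add_mem_coneInterior h hs)⟩
  by_cases ht0 : t = 0
  · exact ⟨1, by simp [ht0]⟩
  by_cases hli : LinearIndependent ℝ ![t, s]
  · refine absurd ?_ hst
    have := hu.smul_mem_coneInterior (hC t ht' s hs' hli (1 / 2) (by norm_num) (by norm_num))
      (show (0 : ℝ) < 2 by norm_num)
    rwa [show (2 : ℝ) • ((1 - 1 / 2 : ℝ) • t + (1 / 2 : ℝ) • s) = s + t by module] at this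
  · rw [LinearIndependent.pair_iff' ht0] at hli
    push Not at hli
    obtain ⟨m, rfl⟩ := hli
    have hm : m + 1 ≠ 0 := by
      intro h
      exact h0 (by rw [show m • t + t = (m + 1) • t by module, h, zero_smul])
    refine ⟨m / (m + 1), ?_⟩
    rw [show m • t + t = (m + 1) • t by module, smul_smul, div_mul_cancel₀ m hm]

end IsOrderUnitSpace

end Topology

/-! ### Order inversions -/

section Inversion

variable {V : Type*} [AddCommGroup V] [Module ℝ V] {C : PointedCone ℝ V} {u x z w : V}
  {g g' : V → V}

/-- `g` and `g'` are mutually inverse antihomogeneous order-antimorphisms of the interior of `C`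
onto itself. Keeping the inverse in the data makes the notion symmetric. -/
structure IsOrderInversion (C : PointedCone ℝ V) (u : V) (g g' : V → V) : Prop where
  unit : IsOrderUnitSpace C u
  unit_ne_zero : u ≠ 0
  map_mem : ∀ x ∈ coneInterior C u, g x ∈ coneInterior C u
  map_mem' : ∀ x ∈ coneInterior C u, g' x ∈ coneInterior C u
  left_inv : ∀ x ∈ coneInterior C u, g' (g x) = x
  right_inv : ∀ x ∈ coneInterior C u, g (g' x) = x
  map_pos_smul : ∀ x ∈ coneInterior C u, ∀ r : ℝ, 0 < r → g (r • x) = r⁻¹ • g x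
  le_iff : ∀ x ∈ coneInterior C u, ∀ y ∈ coneInterior C u, y - x ∈ C ↔ g x - g y ∈ C

theorem exists_isOrderInversion (hu : IsOrderUnitSpace C u) (hu0 : u ≠ 0)
    (hbij : Set.BijOn g (coneInterior C u) (coneInterior C u)) (hhom : IsAntihomogeneous C u g)
    (hanti : IsOrderAntimorphism C u g) : ∃ g', IsOrderInversion C u g g' := by
  have hinv := hbij.invOn_invFunOn
  exact ⟨Function.invFunOn g (coneInterior C u), {
    unit := hu
    unit_ne_zero := hu0
    map_mem := fun x hx => hbij.mapsTo hx
    map_mem' := fun x hx => hbij.surjOn.mapsTo_invFunOn hx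
    left_inv := fun x hx => hinv.1 hx
    right_inv := fun x hx => hinv.2 hx
    map_pos_smul := fun x hx r hr => by rw [hhom r hr x hx, one_div]
    le_iff := fun x hx y hy => hanti x hx y hy }⟩

/-- The linear map through which `g` factors, as a function on the interior. It is modelled on the
inversion of a spin factor, where for `x = 1` the numbers `hi` and `lo` are the eigenvalues of `z`
and the Cayley–Hamilton identity `tr z • 1 - det z • z⁻¹ = z` makes it the identity. -/
noncomputable def spectralMap (C : PointedCone ℝ V) (g : V → V) (x z : V) : V :=
  (hi C x z + lo C x z) • g x - (hi C x z * lo C x z) • g z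

namespace IsOrderInversion

variable (h : IsOrderInversion C u g g')
include h

theorem symm : IsOrderInversion C u g' g where
  unit := h.unit
  unit_ne_zero := h.unit_ne_zero
  map_mem := h.map_mem'
  map_mem' := h.map_mem
  left_inv := h.right_inv
  right_inv := h.left_inv
  map_pos_smul x hx r hr := by
    have hy := h.map_mem' x hx
    have hry := h.unit.smul_mem_coneInterior hy (inv_pos.2 hr)
    have := h.map_pos_smul _ hy _ (inv_pos.2 hr)
    rw [h.right_inv x hx, inv_inv] at this
    rw [← this, h.left_inv _ hry]
  le_iff x hx y hy := by
    rw [h.le_iff _ (h.map_mem' y hy) _ (h.map_mem' x hx), h.right_inv x hx, h.right_inv y hy]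

theorem isOrderUnitSpace (hx : x ∈ coneInterior C u) : IsOrderUnitSpace C x :=
  h.unit.of_mem_coneInterior hx

theorem ne_zero (hx : x ∈ coneInterior C u) : x ≠ 0 :=
  h.unit.ne_zero_of_mem_coneInterior h.unit_ne_zero hx

theorem lo_pos (hx : x ∈ coneInterior C u) (hz : z ∈ coneInterior C u) : 0 < lo C x z :=
  (h.unit.mem_coneInterior_iff_lo_pos h.unit_ne_zero hx).1 hz

theorem hi_pos (hx : x ∈ coneInterior C u) (hz : z ∈ coneInterior C u) : 0 < hi C x z :=
  (h.lo_pos hx hz).trans_le ((h.isOrderUnitSpace hx).lo_le_hi (h.ne_zero hx) z)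

theorem le_smul_iff (hx : x ∈ coneInterior C u) (hz : z ∈ coneInterior C u) {r : ℝ} (hr : 0 < r) :
    r • x - z ∈ C ↔ g z - r⁻¹ • g x ∈ C := by
  rw [h.le_iff _ hz _ (h.unit.smul_mem_coneInterior hx hr), h.map_pos_smul _ hx _ hr]

theorem smul_le_iff (hx : x ∈ coneInterior C u) (hz : z ∈ coneInterior C u) {r : ℝ} (hr : 0 < r) :
    z - r • x ∈ C ↔ r⁻¹ • g x - g z ∈ C := by
  rw [h.le_iff _ (h.unit.smul_mem_coneInterior hx hr) _ hz, h.map_pos_smul _ hx _ hr]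

theorem lo_map (hx : x ∈ coneInterior C u) (hz : z ∈ coneInterior C u) :
    lo C (g x) (g z) = (hi C x z)⁻¹ := by
  have hgx := h.map_mem x hx
  have hgz := h.map_mem z hz
  have h1 := h.hi_pos hx hz
  have h2 := h.lo_pos hgx hgz
  apply le_antisymm
  · rw [le_inv_comm₀ h2 h1, (h.isOrderUnitSpace hx).hi_le_iff (h.ne_zero hx),
      h.le_smul_iff hx hz (inv_pos.2 h2), inv_inv]
    exact (h.isOrderUnitSpace hgx).sub_lo_smul_mem (h.ne_zero hgx) _
  · rw [(h.isOrderUnitSpace hgx).le_lo_iff (h.ne_zero hgx), ← h.le_smul_iff hx hz h1]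
    exact (h.isOrderUnitSpace hx).hi_smul_sub_mem (h.ne_zero hx) _

theorem hi_map (hx : x ∈ coneInterior C u) (hz : z ∈ coneInterior C u) :
    hi C (g x) (g z) = (lo C x z)⁻¹ := by
  have := h.symm.lo_map (h.map_mem x hx) (h.map_mem z hz)
  rw [h.left_inv x hx, h.left_inv z hz] at this
  rw [this, inv_inv]

theorem spectralMap_self (hx : x ∈ coneInterior C u) : spectralMap C g x x = g x := by
  rw [spectralMap, (h.isOrderUnitSpace hx).lo_self (h.ne_zero hx),
    (h.isOrderUnitSpace hx).hi_self (h.ne_zero hx)]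
  module

theorem spectralMap_smul (hx : x ∈ coneInterior C u) (hz : z ∈ coneInterior C u) {r : ℝ}
    (hr : 0 < r) : spectralMap C g x (r • z) = r • spectralMap C g x z := by
  rw [spectralMap, spectralMap, (h.isOrderUnitSpace hx).lo_smul (h.ne_zero hx) _ hr,
    (h.isOrderUnitSpace hx).hi_smul (h.ne_zero hx) _ hr, h.map_pos_smul z hz r hr, smul_smul,
    show r * hi C x z * (r * lo C x z) * r⁻¹ = r * (hi C x z * lo C x z) by field_simp]
  module

/-- Strict convexity forces `g` to preserve projective segments. With `p = hi C x z` and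
`q = lo C x z`, both `q⁻¹ • g x - g z` and `g z - p⁻¹ • g x` are boundary elements, hence extreme.
Each is the sum of a multiple of the corresponding element for `z + r • x` and of another element
of the cone, which places `g (z + r • x)` in the plane of `g x` and `g z`, at a point determined by
the bounds. -/
theorem spectralMap_add_smul (hC : IsStrictlyConvexCone C u) (hx : x ∈ coneInterior C u)
    (hz : z ∈ coneInterior C u) {r : ℝ} (hr : 0 ≤ r) :
    spectralMap C g x (z + r • x) = spectralMap C g x z + r • g x := by
  have hxo := h.isOrderUnitSpace hx
  have hx0 := h.ne_zero hx
  have hz' : z + r • x ∈ coneInterior C u :=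
    h.unit.add_mem_coneInterior hz (C.smul_mem hr hxo.unit_mem)
  have hgx := h.map_mem x hx
  have hXo := h.isOrderUnitSpace hgx
  have hX0 := h.ne_zero hgx
  have hq := h.lo_pos hx hz
  have hp := h.hi_pos hx hz
  have hq' := h.lo_pos hx hz'
  have hp' := h.hi_pos hx hz'
  have hlo := h.lo_map hx hz
  have hhi := h.hi_map hx hz
  have hlo' := h.lo_map hx hz'
  have hhi' := h.hi_map hx hz'
  have eq' := hxo.lo_add_smul hx0 z r
  have ep' := hxo.hi_add_smul hx0 z r
  have hzq := hxo.sub_lo_smul_mem hx0 z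
  have hzp := hxo.hi_smul_sub_mem hx0 z
  have hZp := hXo.sub_lo_smul_mem hX0 (g (z + r • x))
  have hZq := hXo.hi_smul_sub_mem hX0 (g (z + r • x))
  by_cases hpq : lo C x z = hi C x z
  · have e := hxo.eq_smul_of_lo_eq_hi hx0 hpq
    set p := hi C x z
    have hpr : 0 < p + r := by linarith
    rw [e, ← add_smul, h.spectralMap_smul hx hx hpr, h.spectralMap_smul hx hx hp,
      h.spectralMap_self hx, add_smul]
  have hne : lo C (g x) (g z) ≠ hi C (g x) (g z) := by
    rw [hlo, hhi]
    exact fun e => hpq (inv_injective e).symm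
  unfold spectralMap
  rw [hlo'] at hZp
  rw [hhi'] at hZq
  rw [ep'] at hZp hp' ⊢
  rw [eq'] at hZq hq' ⊢
  clear eq' ep' hlo' hhi'
  generalize hX : g x = X at *
  generalize hY : g z = Y at *
  generalize hZ : g (z + r • x) = Z at *
  generalize hpdef : hi C x z = p at *
  generalize hqdef : lo C x z = q at *
  -- `z` lies between `(q / (q + r)) • z'` and `(p / (p + r)) • z'`, with `z' = z + r • x`.
  have hYZ : ((q + r) / q) • Z - Y ∈ C := by
    have : z - (q / (q + r)) • (z + r • x) ∈ C := by
      refine mem_cone_of_eq ?_ (C.smul_mem (show 0 ≤ r / (q + r) by positivity) hzq)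
      match_scalars <;> field_simp
      ring
    rwa [h.smul_le_iff hz' hz (by positivity), hZ, hY, inv_div] at this
  have hZY : Y - ((p + r) / p) • Z ∈ C := by
    have : (p / (p + r)) • (z + r • x) - z ∈ C := by
      refine mem_cone_of_eq ?_ (C.smul_mem (show 0 ≤ r / (p + r) by positivity) hzp)
      match_scalars <;> field_simp
      ring
    rwa [h.le_smul_iff hz' hz (by positivity), hZ, hY, inv_div] at this
  have e1 : ((q + r) / q) • ((q + r)⁻¹ • X - Z) + (((q + r) / q) • Z - Y) = q⁻¹ • X - Y := by
    match_scalars <;> field_simp; ring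
  have e2 : ((p + r) / p) • (Z - (p + r)⁻¹ • X) + (Y - ((p + r) / p) • Z) = Y - p⁻¹ • X := by
    match_scalars <;> field_simp; ring
  obtain ⟨κ, hκ⟩ := h.unit.exists_eq_smul_add hC
    (C.smul_mem (show 0 ≤ (q + r) / q by positivity) hZq) hYZ
    (by
      rw [e1, h.unit.mem_coneInterior_iff_lo_pos h.unit_ne_zero hgx,
        show q⁻¹ • X - Y = -Y + q⁻¹ • X by module, hXo.lo_add_smul hX0]
      rw [hi] at hhi
      linarith)
    (by
      intro e
      rw [e1] at e
      have := (hXo.eq_zero_of_smul_eq_smul hX0 hne (r := q⁻¹) (s := 1) (by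
        rw [one_smul]; exact sub_eq_zero.1 e)).2
      exact one_ne_zero this)
  obtain ⟨μ, hμ⟩ := h.unit.exists_eq_smul_add hC
    (C.smul_mem (show 0 ≤ (p + r) / p by positivity) hZp) hZY
    (by
      rw [e2, h.unit.mem_coneInterior_iff_lo_pos h.unit_ne_zero hgx,
        show Y - p⁻¹ • X = Y + (-p⁻¹) • X by module, hXo.lo_add_smul hX0]
      linarith)
    (by
      intro e
      rw [e2] at e
      have := (hXo.eq_zero_of_smul_eq_smul hX0 hne (r := p⁻¹) (s := 1) (by
        rw [one_smul]; exact (sub_eq_zero.1 e).symm)).2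
      exact one_ne_zero this)
  rw [e1] at hκ
  rw [e2] at hμ
  -- The two expressions for `Z`, cleared of denominators.
  have hκ' : (q + r) • Z = X - κ • (X - q • Y) := by
    have := congrArg (fun v => q • v) hκ
    simp only [smul_sub, smul_smul] at this ⊢
    rw [show q * ((q + r) / q * (q + r)⁻¹) = 1 by field_simp,
      show q * ((q + r) / q) = q + r by field_simp, show q * (κ * q⁻¹) = κ by field_simp] at this
    rw [← sub_eq_zero] at this ⊢
    rw [← neg_eq_zero, ← this]
    module
  have hμ' : (p + r) • Z = X + μ • (p • Y - X) := by
    have := congrArg (fun v => p • v) hμ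
    simp only [smul_sub, smul_smul] at this ⊢
    rw [show p * ((p + r) / p * (p + r)⁻¹) = 1 by field_simp,
      show p * ((p + r) / p) = p + r by field_simp, show p * (μ * p⁻¹) = μ by field_simp] at this
    rw [← sub_eq_zero] at this ⊢
    rw [← this]
    module
  have hcmp : ((p + r) * (1 - κ) - (q + r) * (1 - μ)) • X =
      ((q + r) * μ * p - (p + r) * κ * q) • Y := by
    have h1 := congrArg (fun v => (p + r) • v) hκ'
    have h2 := congrArg (fun v => (q + r) • v) hμ'
    change (p + r) • (q + r) • Z = _ at h1
    change (q + r) • (p + r) • Z = _ at h2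
    rw [smul_comm, h2, ← sub_eq_zero] at h1
    rw [← sub_eq_zero, ← neg_eq_zero, ← h1]
    module
  obtain ⟨c1, c2⟩ := hXo.eq_zero_of_smul_eq_smul hX0 hne hcmp
  have hκp : (p + r) * κ = p := by
    have : ((p + r) * κ - p) * (q - p) = 0 := by linear_combination p * c1 - c2
    rcases mul_eq_zero.1 this with e | e
    · linarith
    · exact absurd (by linarith) hpq
  have hprod : ((p + r) * (q + r)) • Z = r • X + (p * q) • Y := by
    rw [mul_smul, hκ', smul_sub, smul_smul, hκp]
    module
  rw [hprod]
  module

end IsOrderInversion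

end Inversion

/-! ### Linearity of the spectral map -/

section Linear

variable {V : Type*} [AddCommGroup V] [Module ℝ V] {C : PointedCone ℝ V} {u x z w : V}
  {g g' : V → V}

/-- The extension of the spectral map from the interior to the whole space which commutes with
adding multiples of `x`, respectively of `g x`. Any multiple of `x` that moves `v` into the interior
would give the same value; `v + (1 - lo C x v) • x` has lower bound `1`. -/
noncomputable def spectralExt (C : PointedCone ℝ V) (g : V → V) (x v : V) : V :=
  spectralMap C g x (v + (1 - lo C x v) • x) - (1 - lo C x v) • g x

/-- The order unit norm, in terms of the bounds. -/
noncomputable def boundNorm (C : PointedCone ℝ V) (x v : V) : ℝ := max (hi C x v) (hi C x (-v))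

namespace IsOrderUnitSpace

theorem hi_add_hi_neg_nonneg (hx : IsOrderUnitSpace C x) (hx0 : x ≠ 0) (v : V) :
    0 ≤ hi C x v + hi C x (-v) := by
  have := hx.hi_add_le hx0 v (-v)
  rwa [add_neg_cancel, hx.hi_zero hx0] at this

theorem boundNorm_le_iff (hx : IsOrderUnitSpace C x) (hx0 : x ≠ 0) {v : V} {r : ℝ} :
    boundNorm C x v ≤ r ↔ r • x - v ∈ C ∧ r • x + v ∈ C := by
  rw [boundNorm, max_le_iff, hx.hi_le_iff hx0, hx.hi_le_iff hx0, sub_neg_eq_add]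

theorem boundNorm_smul_pos (hx : IsOrderUnitSpace C x) (hx0 : x ≠ 0) {r : ℝ} (hr : 0 < r) (v : V) :
    boundNorm C x (r • v) = r * boundNorm C x v := by
  rw [boundNorm, boundNorm, ← smul_neg, hx.hi_smul hx0 _ hr, hx.hi_smul hx0 _ hr,
    mul_max_of_nonneg _ _ hr.le]

theorem boundNorm_neg (v : V) : boundNorm C x (-v) = boundNorm C x v := by
  rw [boundNorm, boundNorm, neg_neg, max_comm]

theorem boundNorm_core (hx : IsOrderUnitSpace C x) (hx0 : x ≠ 0) :
    letI : Norm V := ⟨boundNorm C x⟩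
    NormedSpace.Core ℝ V :=
  letI : Norm V := ⟨boundNorm C x⟩
  have hzero : boundNorm C x (0 : V) = 0 := by
    rw [boundNorm, neg_zero, hx.hi_zero hx0, max_self]
  { norm_nonneg := fun v => by
      have h1 : hi C x v ≤ boundNorm C x v := le_max_left _ _
      have h2 : hi C x (-v) ≤ boundNorm C x v := le_max_right _ _
      have h3 := hx.hi_add_hi_neg_nonneg hx0 v
      change 0 ≤ boundNorm C x v
      linarith
    norm_smul := fun r v => by
      change boundNorm C x (r • v) = |r| * boundNorm C x v
      rcases lt_trichotomy r 0 with hr | rfl | hr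
      · rw [abs_of_neg hr, ← boundNorm_neg, ← neg_smul, hx.boundNorm_smul_pos hx0 (neg_pos.2 hr)]
      · rw [zero_smul, abs_zero, zero_mul, hzero]
      · rw [abs_of_pos hr, hx.boundNorm_smul_pos hx0 hr]
    norm_triangle := fun v w => by
      refine max_le ((hx.hi_add_le hx0 v w).trans (add_le_add (le_max_left _ _) (le_max_left _ _)))
        ?_
      rw [neg_add]
      exact (hx.hi_add_le hx0 _ _).trans (add_le_add (le_max_right _ _) (le_max_right _ _))
    norm_eq_zero_iff := fun v => by
      change boundNorm C x v = 0 ↔ v = 0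
      refine ⟨fun hv => ?_, fun hv => hv ▸ hzero⟩
      obtain ⟨h1, h2⟩ := (hx.boundNorm_le_iff hx0).1 hv.le
      exact hx.salient v (mem_cone_of_eq (by module) h2) (mem_cone_of_eq (by module) h1) }

end IsOrderUnitSpace

/-- The Mazur–Ulam theorem for the norms of two order units on the same space. -/
theorem isLinearMap_of_boundNorm_isometry {y : V} (hx : IsOrderUnitSpace C x) (hx0 : x ≠ 0)
    (hy : IsOrderUnitSpace C y) (hy0 : y ≠ 0) {f : V → V} (hf : Function.Surjective f)
    (hf0 : f 0 = 0) (hiso : ∀ v w, boundNorm C y (f v - f w) = boundNorm C x (v - w)) :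
    IsLinearMap ℝ f := by
  have key : ∀ {E F : Type _} [NormedAddCommGroup E] [NormedSpace ℝ E] [NormedAddCommGroup F]
      [NormedSpace ℝ F] (f : E → F), Function.Surjective f → f 0 = 0 →
      (∀ v w, ‖f v - f w‖ = ‖v - w‖) → IsLinearMap ℝ f := by
    intro E F _ _ _ _ f hf hf0 hiso
    have hi : Isometry f := Isometry.of_dist_eq fun v w => by
      rw [dist_eq_norm, dist_eq_norm, hiso]
    let e : E ≃ᵢ F := IsometryEquiv.mk (Equiv.ofBijective f ⟨hi.injective, hf⟩) hi
    exact (e.toRealLinearIsometryEquivOfMapZero hf0).toLinearEquiv.toLinearMap.isLinear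
  let n1 : Norm V := ⟨boundNorm C x⟩
  let n2 : Norm V := ⟨boundNorm C y⟩
  let i1 := @NormedAddCommGroup.ofCore ℝ V _ _ _ n1 (hx.boundNorm_core hx0)
  let i2 := @NormedAddCommGroup.ofCore ℝ V _ _ _ n2 (hy.boundNorm_core hy0)
  exact @key V V i1 (@NormedSpace.ofCore ℝ V _ i1.toSeminormedAddCommGroup _ (hx.boundNorm_core hx0))
    i2 (@NormedSpace.ofCore ℝ V _ i2.toSeminormedAddCommGroup _ (hy.boundNorm_core hy0)) f hf hf0 hiso

namespace IsOrderInversion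

variable (h : IsOrderInversion C u g g') (hC : IsStrictlyConvexCone C u)
include h hC

/-- The spectral map is minus the directional derivative of the order-antimorphism `g` at `x`, so it
preserves the order. The derivative is taken in the form of the asymptotics of
`g (z + ε⁻¹ • x)` as `ε → 0`. -/
theorem spectralMap_mono (hx : x ∈ coneInterior C u) (hz : z ∈ coneInterior C u)
    (hw : w ∈ coneInterior C u) (hzw : w - z ∈ C) :
    spectralMap C g x w - spectralMap C g x z ∈ C := by
  have hxo := h.isOrderUnitSpace hx
  have hx0 := h.ne_zero hx
  set p := hi C x z with hp
  set q := lo C x z with hq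
  set p' := hi C x w with hp'
  set q' := lo C x w with hq'
  have hp0 : 0 < p := h.hi_pos hx hz
  have hq0 : 0 < q := h.lo_pos hx hz
  have hp0' : 0 < p' := h.hi_pos hx hw
  have hq0' : 0 < q' := h.lo_pos hx hw
  refine hxo.mem_of_forall_quadratic_mem
    (b := (p + q) • spectralMap C g x w - (p' + q') • spectralMap C g x z
      + (p' * q' - p * q) • g x)
    (d := (p * q) • spectralMap C g x w - (p' * q') • spectralMap C g x z
      + (p' * q' * (p + q) - p * q * (p' + q')) • g x) fun ε hε => ?_
  have hs : 0 < ε⁻¹ := inv_pos.2 hε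
  have key : ∀ v ∈ coneInterior C u, v + ε⁻¹ • x ∈ coneInterior C u ∧
      ((1 + ε * hi C x v) * (1 + ε * lo C x v)) • g (v + ε⁻¹ • x) =
        (ε * (1 + ε * (hi C x v + lo C x v))) • g x - (ε * ε) • spectralMap C g x v := by
    intro v hv
    refine ⟨h.unit.add_mem_coneInterior hv (C.smul_mem hs.le hxo.unit_mem), ?_⟩
    have h1 := h.spectralMap_add_smul hC hx hv hs.le
    rw [← sub_eq_iff_eq_add] at h1
    rw [← h1, spectralMap, hxo.lo_add_smul hx0, hxo.hi_add_smul hx0]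
    match_scalars <;> field_simp <;> ring
  obtain ⟨hz', ez⟩ := key z hz
  obtain ⟨hw', ew⟩ := key w hw
  rw [← hp, ← hq] at ez
  rw [← hp', ← hq'] at ew
  have hle := (h.le_iff _ hz' _ hw').1 (mem_cone_of_eq (by module) hzw)
  have h2 := C.smul_mem (show 0 ≤ (1 + ε * p) * (1 + ε * q) * ((1 + ε * p') * (1 + ε * q'))
    by positivity) hle
  rw [smul_sub, mul_smul _ _ (g (w + ε⁻¹ • x)), ew, mul_comm, mul_smul, ez] at h2
  rw [← C.smul_mem_iff (show 0 < ε * ε by positivity)]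
  refine mem_cone_of_eq ?_ h2
  module

omit hC in
/-- The spectral map of `g` at `x` and that of its inverse at `g x` are inverse to each other, up to
the reflections `v ↦ κ • x - v`. -/
theorem spectralMap_reflection (hx : x ∈ coneInterior C u) (hz : z ∈ coneInterior C u) :
    (hi C x z + lo C x z) • g x - spectralMap C g x z ∈ coneInterior C u ∧
    spectralMap C g' (g x) ((hi C x z + lo C x z) • g x - spectralMap C g x z) =
      (hi C x z + lo C x z) • x - z := by
  have hp := h.hi_pos hx hz
  have hq := h.lo_pos hx hz
  have hgx := h.map_mem x hx
  have hgz := h.map_mem z hz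
  have e : (hi C x z + lo C x z) • g x - spectralMap C g x z = (hi C x z * lo C x z) • g z := by
    rw [spectralMap]; module
  rw [e]
  refine ⟨h.unit.smul_mem_coneInterior hgz (by positivity), ?_⟩
  rw [h.symm.spectralMap_smul hgx hgz (by positivity), spectralMap, h.hi_map hx hz, h.lo_map hx hz,
    h.left_inv x hx, h.left_inv z hz]
  match_scalars <;> field_simp

theorem spectralMap_reflection_of_le (hx : x ∈ coneInterior C u) (hz : z ∈ coneInterior C u)
    {κ : ℝ} (hκ : hi C x z + lo C x z ≤ κ) :
    κ • g x - spectralMap C g x z ∈ coneInterior C u ∧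
    spectralMap C g' (g x) (κ • g x - spectralMap C g x z) = κ • x - z := by
  obtain ⟨h1, h2⟩ := h.spectralMap_reflection hx hz
  have hgx := h.map_mem x hx
  have e : κ • g x - spectralMap C g x z =
      ((hi C x z + lo C x z) • g x - spectralMap C g x z) + (κ - (hi C x z + lo C x z)) • g x := by
    module
  rw [e]
  refine ⟨h.unit.add_mem_coneInterior h1 (C.smul_mem (sub_nonneg.2 hκ)
    (h.unit.mem_of_mem_coneInterior hgx)), ?_⟩
  rw [h.symm.spectralMap_add_smul hC hgx h1 (sub_nonneg.2 hκ), h2, h.left_inv x hx]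
  module

theorem spectralMap_le_iff (hx : x ∈ coneInterior C u) (hz : z ∈ coneInterior C u)
    (hw : w ∈ coneInterior C u) :
    spectralMap C g x w - spectralMap C g x z ∈ C ↔ w - z ∈ C := by
  refine ⟨fun hle => ?_, h.spectralMap_mono hC hx hz hw⟩
  obtain ⟨hz1, hz2⟩ := h.spectralMap_reflection_of_le hC hx hz
    (le_max_left (hi C x z + lo C x z) (hi C x w + lo C x w))
  obtain ⟨hw1, hw2⟩ := h.spectralMap_reflection_of_le hC hx hw
    (le_max_right (hi C x z + lo C x z) (hi C x w + lo C x w))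
  have := h.symm.spectralMap_mono hC (h.map_mem x hx) hw1 hz1 (mem_cone_of_eq (by module) hle)
  rw [hz2, hw2] at this
  exact mem_cone_of_eq (by module) this

omit hC in
theorem add_smul_mem_coneInterior (hx : x ∈ coneInterior C u) {v : V} {r : ℝ}
    (hr : 0 < lo C x v + r) : v + r • x ∈ coneInterior C u := by
  rwa [h.unit.mem_coneInterior_iff_lo_pos h.unit_ne_zero hx,
    (h.isOrderUnitSpace hx).lo_add_smul (h.ne_zero hx)]

theorem spectralExt_eq (hx : x ∈ coneInterior C u) {v : V} {r : ℝ}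
    (hr : 0 < lo C x v + r) :
    spectralExt C g x v = spectralMap C g x (v + r • x) - r • g x := by
  have key : ∀ r s : ℝ, r ≤ s → 0 < lo C x v + r →
      spectralMap C g x (v + s • x) - s • g x = spectralMap C g x (v + r • x) - r • g x := by
    intro r s hrs hr
    rw [show v + s • x = (v + r • x) + (s - r) • x by module,
      h.spectralMap_add_smul hC hx (h.add_smul_mem_coneInterior hx hr) (sub_nonneg.2 hrs)]
    module
  unfold spectralExt
  rcases le_total r (1 - lo C x v) with hle | hle
  · exact key _ _ hle hr
  · exact (key _ _ hle (by linarith)).symm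

theorem spectralExt_of_mem (hx : x ∈ coneInterior C u) (hz : z ∈ coneInterior C u) :
    spectralExt C g x z = spectralMap C g x z := by
  rw [h.spectralExt_eq hC hx (r := 0) (by simpa using h.lo_pos hx hz)]
  simp

theorem spectralExt_add_smul (hx : x ∈ coneInterior C u) (v : V) (r : ℝ) :
    spectralExt C g x (v + r • x) = spectralExt C g x v + r • g x := by
  have e := (h.isOrderUnitSpace hx).lo_add_smul (h.ne_zero hx) v r
  rw [h.spectralExt_eq hC hx (v := v) (r := 1 - lo C x v) (by linarith),
    h.spectralExt_eq hC hx (v := v + r • x) (r := 1 - lo C x v - r) (by linarith),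
    show v + r • x + (1 - lo C x v - r) • x = v + (1 - lo C x v) • x by module]
  module

theorem spectralExt_le_iff (hx : x ∈ coneInterior C u) (v w : V) :
    spectralExt C g x w - spectralExt C g x v ∈ C ↔ w - v ∈ C := by
  set r := max (1 - lo C x v) (1 - lo C x w)
  have h1 : 0 < lo C x v + r := by linarith [le_max_left (1 - lo C x v) (1 - lo C x w)]
  have h2 : 0 < lo C x w + r := by linarith [le_max_right (1 - lo C x v) (1 - lo C x w)]
  rw [h.spectralExt_eq hC hx h1, h.spectralExt_eq hC hx h2,
    sub_sub_sub_cancel_right, h.spectralMap_le_iff hC hx (h.add_smul_mem_coneInterior hx h1)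
      (h.add_smul_mem_coneInterior hx h2), add_sub_add_right_eq_sub]

theorem spectralExt_surjective (hx : x ∈ coneInterior C u) :
    Function.Surjective (spectralExt C g x) := by
  intro w
  have hgx := h.map_mem x hx
  set μ := 1 - lo C (g x) (-w) with hμ
  have hZ : -w + μ • g x ∈ coneInterior C u :=
    h.add_smul_mem_coneInterior hgx (by rw [hμ]; linarith)
  obtain ⟨h1, h2⟩ := h.symm.spectralMap_reflection hgx hZ
  rw [h.left_inv x hx] at h1 h2
  set κ := hi C (g x) (-w + μ • g x) + lo C (g x) (-w + μ • g x)
  refine ⟨(κ • x - spectralMap C g' (g x) (-w + μ • g x)) + (μ - κ) • x, ?_⟩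
  rw [h.spectralExt_add_smul hC hx, h.spectralExt_of_mem hC hx h1, h2]
  module

theorem isLinearMap_spectralExt (hx : x ∈ coneInterior C u) :
    IsLinearMap ℝ (spectralExt C g x) := by
  have hxo := h.isOrderUnitSpace hx
  have hx0 := h.ne_zero hx
  have hXo := h.isOrderUnitSpace (h.map_mem x hx)
  have hX0 := h.ne_zero (h.map_mem x hx)
  refine isLinearMap_of_boundNorm_isometry hxo hx0 hXo hX0 (h.spectralExt_surjective hC hx) ?_ ?_
  · have := h.spectralExt_add_smul hC hx 0 1
    rw [zero_add, one_smul, one_smul, h.spectralExt_of_mem hC hx hx, h.spectralMap_self hx] at this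
    exact add_eq_right.1 this.symm
  · intro v w
    have key : ∀ (v w : V) (r : ℝ), r • g x - (spectralExt C g x v - spectralExt C g x w) ∈ C ↔
        r • x - (v - w) ∈ C := by
      intro v w r
      rw [show r • x - (v - w) = (w + r • x) - v by module,
        ← h.spectralExt_le_iff hC hx v (w + r • x), h.spectralExt_add_smul hC hx,
        show ∀ a b c : V, a - (b - c) = c + a - b from fun a b c => by abel]
    refine eq_of_forall_ge_iff fun r => ?_
    rw [hXo.boundNorm_le_iff hX0, hxo.boundNorm_le_iff hx0, key v w,
      show ∀ a b c : V, a + (b - c) = a - (c - b) from fun a b c => by abel, key w v,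
      show ∀ a b c : V, a + (b - c) = a - (c - b) from fun a b c => by abel]

end IsOrderInversion

end Linear

/-! ### One-sided derivatives of the bounds -/

section Smooth

open Filter Topology Set

variable {V : Type*} [AddCommGroup V] [Module ℝ V] {C : PointedCone ℝ V} {u x y z w : V}
  {g g' : V → V}

/-- The one-sided directional derivative of `lo C x` at `y` in the direction `v`. -/
noncomputable def loDeriv (C : PointedCone ℝ V) (x y v : V) : ℝ :=
  derivWithin (fun t : ℝ => lo C x (y + t • v)) (Ioi 0) 0

/-- The one-sided directional derivative of `hi C x` at `y` in the direction `v`. -/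
noncomputable def hiDeriv (C : PointedCone ℝ V) (x y v : V) : ℝ := -loDeriv C x (-y) (-v)

namespace IsOrderUnitSpace

theorem concaveOn_lo (hx : IsOrderUnitSpace C x) (hx0 : x ≠ 0) (y v : V) :
    ConcaveOn ℝ univ (fun t : ℝ => lo C x (y + t • v)) := by
  refine ⟨convex_univ, fun s _ t _ a b ha hb hab => ?_⟩
  obtain rfl : b = 1 - a := by linarith
  refine (hx.le_lo_iff hx0).2 (mem_cone_of_eq ?_
    (C.add_mem (C.smul_mem ha (hx.sub_lo_smul_mem hx0 (y + s • v)))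
      (C.smul_mem hb (hx.sub_lo_smul_mem hx0 (y + t • v)))))
  simp only [smul_eq_mul]
  module

theorem hasDerivWithinAt_lo (hx : IsOrderUnitSpace C x) (hx0 : x ≠ 0) (y v : V) :
    HasDerivWithinAt (fun t : ℝ => lo C x (y + t • v)) (loDeriv C x y v) (Ioi 0) 0 := by
  have h1 := (hx.concaveOn_lo hx0 y v).neg.differentiableWithinAt_Ioi_of_mem_interior
    (x := 0) (by simp)
  have h2 := h1.neg
  rw [neg_neg] at h2
  exact h2.hasDerivWithinAt

theorem hasDerivWithinAt_hi (hx : IsOrderUnitSpace C x) (hx0 : x ≠ 0) (y v : V) :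
    HasDerivWithinAt (fun t : ℝ => hi C x (y + t • v)) (hiDeriv C x y v) (Ioi 0) 0 := by
  have h1 := (hx.hasDerivWithinAt_lo hx0 (-y) (-v)).neg
  refine h1.congr_of_eventuallyEq (Eventually.of_forall fun t => ?_) ?_
  · change hi C x (y + t • v) = -lo C x (-y + t • -v)
    rw [hi, show -(y + t • v) = -y + t • -v by module]
  · change hi C x (y + (0 : ℝ) • v) = -lo C x (-y + (0 : ℝ) • -v)
    rw [hi, show -(y + (0 : ℝ) • v) = -y + (0 : ℝ) • -v by module]

theorem lo_add_sub_lo_le_loDeriv (hx : IsOrderUnitSpace C x) (hx0 : x ≠ 0) (y v : V) :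
    lo C x (y + v) - lo C x y ≤ loDeriv C x y v := by
  have := (hx.concaveOn_lo hx0 y v).slope_le_of_hasDerivWithinAt_Ioi (mem_univ 0) (mem_univ 1)
    one_pos (hx.hasDerivWithinAt_lo hx0 y v)
  simpa [slope_def_field] using this

/-- A positive functional which supports `lo C x` from above at `y` dominates its derivative. -/
theorem loDeriv_le (hx : IsOrderUnitSpace C x) (hx0 : x ≠ 0) {ψ : V →ₗ[ℝ] ℝ}
    (hψ : IsState C x ψ) (hy : ψ y = lo C x y) (v : V) : loDeriv C x y v ≤ ψ v := by
  have h1 := hasDerivWithinAt_iff_tendsto_slope.1 (hx.hasDerivWithinAt_lo hx0 y v)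
  have h2 : (Ioi (0 : ℝ) \ {0}) = Ioi 0 := by simp
  rw [h2] at h1
  refine le_of_tendsto h1 ?_
  filter_upwards [self_mem_nhdsWithin] with t ht
  have ht' : (0 : ℝ) < t := ht
  have h3 := hψ.1 _ (hx.sub_lo_smul_mem hx0 (y + t • v))
  simp only [map_sub, map_add, map_smul, smul_eq_mul, hψ.2, mul_one] at h3
  rw [slope_def_field, div_le_iff₀ (by linarith)]
  simp only [zero_smul, add_zero, sub_zero]
  linarith

end IsOrderUnitSpace

namespace IsOrderInversion

variable (h : IsOrderInversion C u g g') (hC : IsStrictlyConvexCone C u)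
include h hC

theorem smul_map_eq (hx : x ∈ coneInterior C u) (hz : z ∈ coneInterior C u) :
    (hi C x z * lo C x z) • g z = (hi C x z + lo C x z) • g x - spectralExt C g x z := by
  rw [h.spectralExt_of_mem hC hx hz, spectralMap]
  module

/-- The two expressions for `g` near `y`, with base points `x` and `y`, have the same derivative at
`y`. -/
theorem hiDeriv_loDeriv_identity (hx : x ∈ coneInterior C u) (hy : y ∈ coneInterior C u) (v : V) :
    (hiDeriv C x y v * lo C x y + hi C x y * loDeriv C x y v) • g y
      - (hiDeriv C x y v + loDeriv C x y v) • g x =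
      (hi C x y * lo C x y) • spectralExt C g y v - spectralExt C g x v := by
  have hxo := h.isOrderUnitSpace hx
  have hx0 := h.ne_zero hx
  have hyo := h.isOrderUnitSpace hy
  have hy0 := h.ne_zero hy
  have hLx := h.isLinearMap_spectralExt hC hx
  have hLy := h.isLinearMap_spectralExt hC hy
  have hLyy : spectralExt C g y y = g y := by
    rw [h.spectralExt_of_mem hC hy hy, h.spectralMap_self hy]
  set P := hi C y v with hP
  set Q := lo C y v with hQ
  have hcont : Tendsto (fun t : ℝ => 1 + t * Q) (𝓝[>] 0) (𝓝 1) := by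
    have : Continuous fun t : ℝ => 1 + t * Q := by fun_prop
    simpa using (this.tendsto 0).mono_left nhdsWithin_le_nhds
  -- Clearing denominators in the two expressions for `g (y + t • v)`.
  have hev : ∀ᶠ t in 𝓝[>] (0 : ℝ),
      ((1 + t * P) * (1 + t * Q)) • ((hi C x (y + t • v) + lo C x (y + t • v)) • g x
        - spectralExt C g x y - t • spectralExt C g x v) =
      (hi C x (y + t • v) * lo C x (y + t • v)) •
        ((1 + t * (P + Q)) • g y - t • spectralExt C g y v) := by
    filter_upwards [hcont.eventually (lt_mem_nhds one_pos), self_mem_nhdsWithin] with t h1 ht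
    have ht' : (0 : ℝ) < t := ht
    have elo : lo C y (y + t • v) = 1 + t * Q := by
      rw [add_comm y, show t • v + y = t • v + (1 : ℝ) • y by module, hyo.lo_add_smul hy0,
        hyo.lo_smul hy0 _ ht', add_comm]
    have ehi : hi C y (y + t • v) = 1 + t * P := by
      rw [add_comm y, show t • v + y = t • v + (1 : ℝ) • y by module, hyo.hi_add_smul hy0,
        hyo.hi_smul hy0 _ ht', add_comm]
    have hz : y + t • v ∈ coneInterior C u := by
      rw [h.unit.mem_coneInterior_iff_lo_pos h.unit_ne_zero hy, elo]
      exact h1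
    have e1 := h.smul_map_eq hC hx hz
    have e2 := h.smul_map_eq hC hy hz
    rw [hLx.map_add, hLx.map_smul, ← sub_sub] at e1
    rw [hLy.map_add, hLy.map_smul, hLyy, elo, ehi] at e2
    rw [← e1, smul_comm, e2]
    module
  rw [← sub_eq_zero, ← Module.forall_dual_apply_eq_zero_iff ℝ]
  intro (f : V →ₗ[ℝ] ℝ)
  have ha := hxo.hasDerivWithinAt_hi hx0 y v
  have hb := hxo.hasDerivWithinAt_lo hx0 y v
  have hid : HasDerivWithinAt (fun t : ℝ => t) 1 (Ioi 0) 0 := hasDerivWithinAt_id _ _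
  have hl : ∀ c : ℝ, HasDerivWithinAt (fun t : ℝ => 1 + t * c) (1 * c) (Ioi 0) 0 := fun c =>
    (hid.mul_const c).const_add 1
  have hF := ((hl P).mul (hl Q)).mul
    ((((ha.add hb).mul_const (f (g x))).sub_const (f (spectralExt C g x y))).sub
      (hid.mul_const (f (spectralExt C g x v))))
  have hG := (ha.mul hb).mul
    (((hl (P + Q)).mul_const (f (g y))).sub (hid.mul_const (f (spectralExt C g y v))))
  have e0 := congrArg f (h.smul_map_eq hC hx hy)
  simp only [map_sub, map_smul, smul_eq_mul] at e0
  have key := (uniqueDiffWithinAt_Ioi (0 : ℝ)).eq_deriv _ hG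
    (hF.congr_of_eventuallyEq (hev.mono fun t ht => by
      have := congrArg f ht
      simp only [map_sub, map_smul, smul_eq_mul] at this
      exact this.symm) (by
      simp only [Pi.mul_apply, Pi.add_apply, Pi.sub_apply, zero_smul, add_zero, zero_mul, sub_zero,
        mul_one, one_mul]
      exact e0))
  simp only [Pi.mul_apply, Pi.add_apply, Pi.sub_apply, zero_smul, add_zero, zero_mul, sub_zero,
    mul_one, one_mul] at key
  simp only [map_sub, map_smul, smul_eq_mul]
  linear_combination key - (P + Q) * e0

/-- Away from the multiples of `x`, the bound `lo C x` is Gateaux differentiable: its one-sided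
derivative is linear. -/
theorem isLinearMap_loDeriv (hx : x ∈ coneInterior C u) (hy : y ∈ coneInterior C u)
    (hne : lo C x y ≠ hi C x y) : IsLinearMap ℝ (loDeriv C x y) := by
  have hLx := h.isLinearMap_spectralExt hC hx
  have hLy := h.isLinearMap_spectralExt hC hy
  have hgx := h.map_mem x hx
  have hne' : lo C (g x) (g y) ≠ hi C (g x) (g y) := by
    rw [h.lo_map hx hy, h.hi_map hx hy]
    exact fun e => hne (inv_injective e).symm
  -- The coefficients of `g x` and `g y` determine both derivatives, as `lo C x y ≠ hi C x y`.
  have key : ∀ A B : ℝ, (A * lo C x y + hi C x y * B) • g y - (A + B) • g x = 0 → B = 0 := by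
    intro A B e
    obtain ⟨e1, e2⟩ := (h.isOrderUnitSpace hgx).eq_zero_of_smul_eq_smul (h.ne_zero hgx) hne'
      (sub_eq_zero.1 e).symm
    have : (hi C x y - lo C x y) * B = 0 := by linear_combination e2 - lo C x y * e1
    exact (mul_eq_zero.1 this).resolve_left (sub_ne_zero.2 hne.symm)
  have hid := h.hiDeriv_loDeriv_identity hC hx hy
  refine ⟨fun v w => ?_, fun r v => ?_⟩
  · have e1 := hid (v + w)
    rw [hLx.map_add, hLy.map_add] at e1
    have := key (hiDeriv C x y (v + w) - hiDeriv C x y v - hiDeriv C x y w)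
      (loDeriv C x y (v + w) - loDeriv C x y v - loDeriv C x y w)
      (by linear_combination (norm := module) e1 - hid v - hid w)
    linarith
  · have e1 := hid (r • v)
    rw [hLx.map_smul, hLy.map_smul] at e1
    exact sub_eq_zero.1 (key (hiDeriv C x y (r • v) - r * hiDeriv C x y v)
      (loDeriv C x y (r • v) - r * loDeriv C x y v)
      (by linear_combination (norm := module) e1 - r • hid v))

/-- The unique state annihilating a boundary point `η` is the derivative of `lo C u` at `u + η`. -/
theorem existsUnique_isState {η : V} (hη : η ∈ coneBoundary C u) (hη0 : η ≠ 0) :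
    ∃! φ : V →ₗ[ℝ] ℝ, IsState C u φ ∧ φ η = 0 := by
  have hu := h.unit
  have hu0 := h.unit_ne_zero
  have huI := hu.unit_mem_coneInterior
  obtain ⟨hηC, hηI⟩ := hu.mem_coneBoundary_iff.1 hη
  have hlo : lo C u η = 0 := by
    rw [hu.mem_coneInterior_iff_lo_pos hu0 huI] at hηI
    exact le_antisymm (not_lt.1 hηI) ((hu.mem_cone_iff_lo_nonneg hu0).1 hηC)
  have hhi : hi C u η ≠ 0 := by
    intro e
    have := hu.eq_smul_of_lo_eq_hi hu0 (hlo.trans e.symm)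
    rw [e, zero_smul] at this
    exact hη0 this
  have hyI := hu.add_mem_coneInterior huI hηC
  have ey : u + η = η + (1 : ℝ) • u := by module
  have hylo : lo C u (u + η) = 1 := by rw [ey, hu.lo_add_smul hu0, hlo, zero_add]
  have hyhi : hi C u (u + η) = hi C u η + 1 := by rw [ey, hu.hi_add_smul hu0]
  have hne : lo C u (u + η) ≠ hi C u (u + η) := by
    rw [hylo, hyhi]
    exact fun e => hhi (by linarith)
  have hlin := h.isLinearMap_loDeriv hC huI hyI hne
  have hge : ∀ v, lo C u (u + η + v) - 1 ≤ loDeriv C u (u + η) v := fun v =>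
    hylo ▸ hu.lo_add_sub_lo_le_loDeriv hu0 (u + η) v
  -- Lower bounds in the directions `±v` give the value in the direction `v`.
  have hval : ∀ v c, lo C u (u + η + v) = 1 + c → lo C u (u + η + -v) = 1 - c →
      loDeriv C u (u + η) v = c := by
    intro v c h1 h2
    have h3 := hge v
    have h4 := hge (-v)
    rw [hlin.map_neg] at h4
    linarith
  refine ⟨hlin.mk' _, ⟨⟨fun v hv => ?_, ?_⟩, ?_⟩, ?_⟩
  · have h1 := hge v
    have h2 := hu.lo_mono hu0 (v := u + η) (w := u + η + v) (mem_cone_of_eq (by module) hv)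
    change 0 ≤ loDeriv C u (u + η) v
    linarith
  · refine hval u 1 ?_ ?_
    · rw [show u + η + u = η + (2 : ℝ) • u by module, hu.lo_add_smul hu0, hlo]
      norm_num
    · rw [show u + η + -u = η by module, hlo]
      norm_num
  · refine hval η 0 ?_ ?_
    · rw [show u + η + η = (2 : ℝ) • η + (1 : ℝ) • u by module, hu.lo_add_smul hu0,
        hu.lo_smul hu0 _ two_pos, hlo]
      norm_num
    · rw [show u + η + -η = u by module, hu.lo_self hu0]
      norm_num
  · rintro ψ ⟨hψ, hψη⟩
    have hle : ∀ v, loDeriv C u (u + η) v ≤ ψ v :=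
      hu.loDeriv_le hu0 hψ (by rw [map_add, hψ.2, hψη, hylo, add_zero])
    ext v
    change ψ v = loDeriv C u (u + η) v
    have h1 := hle v
    have h2 := hle (-v)
    rw [hlin.map_neg, map_neg] at h2
    linarith

end IsOrderInversion

end Smooth

end OrderUnit

theorem theorem3p2 {V : Type*} [AddCommGroup V] [Module ℝ V] (C : PointedCone ℝ V) (u : V)
    (hV : OrderUnit.IsOrderUnitSpace C u)
    (hdim : 3 ≤ Module.rank ℝ V)
    (hC : OrderUnit.IsStrictlyConvexCone C u)
    (hg : ∃ g : V → V, Set.BijOn g (OrderUnit.coneInterior C u) (OrderUnit.coneInterior C u) ∧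
      OrderUnit.IsAntihomogeneous C u g ∧ OrderUnit.IsOrderAntimorphism C u g) :
    OrderUnit.IsSmoothCone C u := by
  intro η hη hη0
  have hu0 : u ≠ 0 := by
    rintro rfl
    obtain ⟨r, -, hr⟩ := hV.exists_pos_smul_sub_mem η
    exact hη0 (hV.salient η (hV.mem_coneBoundary_iff.1 hη).1
      (OrderUnit.mem_cone_of_eq (by module) hr))
  obtain ⟨g, hbij, hhom, hanti⟩ := hg
  obtain ⟨g', h⟩ := OrderUnit.exists_isOrderInversion hV hu0 hbij hhom hanti
  exact h.existsUnique_isState hC hη hη0
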